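/- Let $\mathbb{F}$ be a field of characteristic $0$. The tetrahedron algebra $\boxtimes$ is the Lie algebra over $\mathbb{F}$ with generators $x_{ij}$ ($i,j\in\{0,1,2,3\}$, $i\neq j$) and relations (i) $x_{ij}+x_{ji}=0$ for distinct $i,j$; (ii) $[x_{hi},x_{ij}]=2x_{hi}+2x_{ij}$ for mutually distinct $h,i,j$; (iii) $[x_{hi},[x_{hi},[x_{hi},x_{jk}]]]=4[x_{hi},x_{jk}]$ for mutually distinct $h,i,j,k$. Let $\mathcal{O}$ be the Lie subalgebra of $\boxtimes$ generated by $x_{12}$ and $x_{03}$. Define $a_n,b_n\in\mathcal{O}$ ($n\ge 0$) by $a_0=x_{12}$, $b_0=x_{03}$ and, for $j\ge 1$, $$a_{2j-1}=[b_0,a_{2j-2}],\quad a_{2j}=[a_0,a_{2j-1}],\qquad b_{2j-1}=[a_0,b_{2j-2}],\quad b_{2j}=[b_0,b_{2j-1}].$$ **Theorem.** The $\mathbb{F}$-vector space $\mathcal{O}$ has a basis $a_{2i},\ b_{2i},\ a_{2i+1}$ ($i\ge 0$). The Lie bracket acts on this basis as follows (with $i,j\geq 0$ integers): $$[a_{2i},a_{2j}]=\begin{cases}0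 & \text{if } i=j=0 \text{ or } i\ge1,\,j\ge1,\\ 4a_{2j-1} & \text{if } i=0,\ j\ge1;\end{cases}$$ $$[b_{2i},a_{2j}]=\begin{cases}a_{2i+1} & \text{if } i\ge0,\ j=0,\\ a_{2j+1} & \text{if } i=0,\ j\ge1,\\ a_{2i+2j+1}-16\,a_{2i+2j-3} & \text{if } i\ge1,\ j\ge1;\end{cases}$$ $$[b_{2i},b_{2j}]=\begin{cases}0 & \text{if } i=j=0 \text{ or } i\ge1,\,j\ge1,\\ 4a_{2i-1} & \text{if } i\ge1,\ j=0;\end{cases}$$ $$[a_{2i},a_{2j+1}]=\begin{cases}a_{2j+2} & \text{if } i=0,\ j\ge0,\\ a_{2i+2j+2}+4b_{2i+2j} & \text{if } i\ge1,\ j\ge0;\end{cases}$$ $$[a_{2i+1},b_{2j}]=\begin{cases}b_{2i+2} & \text{if } i\ge0,\ j=0,\\ b_{2i+2j+2}+4a_{2i+2j} & \text{if } i\ge0,\ j\ge1;\end{cases}$$ $$[a_{2i+1},a_{2j+1}]=0\quad\text{if } i\ge0,\ j\ge0.$$ -/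

import Mathlib

namespace Tetrahedron

/-- Index set of the standard generators: ordered pairs `(i, j)` of distinct elements
of `{0, 1, 2, 3}`. -/
abbrev Gen : Type := {p : Fin 4 × Fin 4 // p.1 ≠ p.2}

/-- The generator attached to `(i, j)`, in the free Lie algebra. -/
noncomputable def freeX (F : Type*) [Field F] (i j : Fin 4) (hij : i ≠ j) :
    FreeLieAlgebra F Gen :=
  FreeLieAlgebra.of F (⟨(i, j), hij⟩ : Gen)

/-- The defining relators of the tetrahedron algebra, as elements of the free Lie algebra. -/
inductive Relator (F : Type*) [Field F] : FreeLieAlgebra F Gen → Prop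
  | skew (i j : Fin 4) (hij : i ≠ j) :
      Relator F (freeX F i j hij + freeX F j i hij.symm)
  | triple (h i j : Fin 4) (hhi : h ≠ i) (hij : i ≠ j) (hhj : h ≠ j) :
      Relator F (⁅freeX F h i hhi, freeX F i j hij⁆
        - ((2 : F) • freeX F h i hhi + (2 : F) • freeX F i j hij))
  | dolanGrady (h i j k : Fin 4) (hhi : h ≠ i) (hhj : h ≠ j) (hhk : h ≠ k)
      (hij : i ≠ j) (hik : i ≠ k) (hjk : j ≠ k) :
      Relator F (⁅freeX F h i hhi, ⁅freeX F h i hhi, ⁅freeX F h i hhi, freeX F j k hjk⁆⁆⁆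
        - (4 : F) • ⁅freeX F h i hhi, freeX F j k hjk⁆)

/-- The ideal of the free Lie algebra generated by the relators. -/
noncomputable def relIdeal (F : Type*) [Field F] : LieIdeal F (FreeLieAlgebra F Gen) :=
  LieSubmodule.lieSpan F (FreeLieAlgebra F Gen) {r | Relator F r}

/-- The tetrahedron algebra over `F`. -/
abbrev Tet (F : Type*) [Field F] : Type _ := FreeLieAlgebra F Gen ⧸ relIdeal F

/-- The standard generator `x_{ij}` of the tetrahedron algebra. -/
noncomputable def x (F : Type*) [Field F] (i j : Fin 4) (hij : i ≠ j) : Tet F :=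
  LieSubmodule.Quotient.mk (freeX F i j hij)

/-- The Onsager subalgebra generated by `x_{12}` and `x_{03}`. -/
noncomputable def Onsager (F : Type*) [Field F] : LieSubalgebra F (Tet F) :=
  LieSubalgebra.lieSpan F (Tet F) {x F 1 2 (by decide), x F 0 3 (by decide)}

/-- `x_{12}` as an element of the Onsager subalgebra. -/
noncomputable def ox12 (F : Type*) [Field F] : Onsager F :=
  ⟨x F 1 2 (by decide), LieSubalgebra.subset_lieSpan (Set.mem_insert _ _)⟩

/-- `x_{03}` as an element of the Onsager subalgebra. -/
noncomputable def ox03 (F : Type*) [Field F] : Onsager F :=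
  ⟨x F 0 3 (by decide), LieSubalgebra.subset_lieSpan (Set.mem_insert_of_mem _ rfl)⟩

/-- The alternating iterated brackets `u, [v, u], [u, [v, u]], [v, [u, [v, u]]], …`. -/
def altBracket {L : Type*} [LieRing L] (u v : L) : ℕ → L
  | 0 => u
  | n + 1 => if Even n then ⁅v, altBracket u v n⁆ else ⁅u, altBracket u v n⁆

/-- `a_0 = x_{12}`, `a_{2j-1} = [x_{03}, a_{2j-2}]`, `a_{2j} = [x_{12}, a_{2j-1}]`. -/
noncomputable def a (F : Type*) [Field F] (n : ℕ) : Onsager F :=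
  altBracket (ox12 F) (ox03 F) n

/-- `b_0 = x_{03}`, `b_{2j-1} = [x_{12}, b_{2j-2}]`, `b_{2j} = [x_{03}, b_{2j-1}]`. -/
noncomputable def b (F : Type*) [Field F] (n : ℕ) : Onsager F :=
  altBracket (ox03 F) (ox12 F) n

end Tetrahedron

/-! Write `u = x₁₂`, `v = x₀₃`. Spanning and all the brackets use only the two Dolan–Grady
relations, which are instances of (iii). In characteristic 0 these imply Onsager's relations
(`DolanGrady.exists_onsager_seq`): there are `A k`, `G k` (`k ∈ ℤ`) with `u = A 0 / 2`, `v = A 1 /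
2`, and the `G k` commute. On the span of the `G k`, `ad u` and `ad v` commute and have square 4
(`exists_abelian_submodule`). That span contains every odd bracket, and the multiplication table
follows formally. The table shows that the span of the family is stable under `ad u` and `ad v`,
hence is the whole subalgebra.

Independence needs a representation of the full tetrahedron algebra, so all three kinds of relations
are checked there: `pointRep` gives 2×2 matrices over `F(s)`. In it `ad v ad u` acts on odd brackets
as the scalar `s`, and transcendence of `s` turns a linear relation into polynomial identities
(`linearIndependent_onsagerFamily`). -/

namespace Tetrahedron

/-! ### From the Dolan–Grady relations to Onsager's relations. -/

section OnsagerRelations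

variable {F L : Type*} [Field F] [LieRing L] [LieAlgebra F L]

/-- The action of a derivation `ad z` that shifts the sequence `A` by `±k` on a bracket. -/
lemma shift_lie_lie (A : ℤ → L) (z : L) (c : F) (k : ℤ)
    (hz : ∀ l, ⁅z, A l⁆ = c • A (l + k) - c • A (l - k)) (m n : ℤ) :
    ⁅z, ⁅A m, A n⁆⁆ = c • (⁅A (m + k), A n⁆ - ⁅A (m - k), A n⁆
      + ⁅A m, A (n + k)⁆ - ⁅A m, A (n - k)⁆) := by
  rw [leibniz_lie, hz, hz]
  simp only [sub_lie, lie_sub, lie_smul, smul_lie]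
  module

lemma exists_recurrent_seq [CharZero F] (g u v : L) :
    ∃ A : ℤ → L, A 0 = u ∧ A 1 = v ∧
      ∀ n, ⁅g, A n⁆ = (2 : F) • A (n + 1) - (2 : F) • A (n - 1) := by
  -- The state is `(A n, A (n + 1))`. The recurrence determines either neighbour, so the shift is a
  -- permutation and its integer powers define `A` on all of `ℤ`.
  let e : Equiv.Perm (L × L) :=
    { toFun := fun q => (q.2, (2⁻¹ : F) • ⁅g, q.2⁆ + q.1)
      invFun := fun q => (q.2 - (2⁻¹ : F) • ⁅g, q.1⁆, q.1)
      left_inv := fun q => by simp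
      right_inv := fun q => by simp }
  have key : ∀ n : ℤ, (e ^ (n + 1)) (u, v) = e ((e ^ n) (u, v)) := fun n => by
    rw [add_comm, zpow_add, zpow_one, Equiv.Perm.mul_apply]
  have h1 : ∀ n : ℤ, ((e ^ n) (u, v)).2 = ((e ^ (n + 1)) (u, v)).1 := fun n => by
    rw [key]; rfl
  refine ⟨fun n => ((e ^ n) (u, v)).1, by simp, ?_, fun n => ?_⟩
  · change ((e ^ (0 + 1 : ℤ)) (u, v)).1 = v
    rw [← h1]; simp
  · have h2 : ((e ^ (n + 1)) (u, v)).1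
        = (2⁻¹ : F) • ⁅g, ((e ^ n) (u, v)).1⁆ + ((e ^ (n - 1)) (u, v)).1 := by
      have h3 := key (n - 1)
      rw [sub_add_cancel] at h3
      rw [← h1, h3]; rfl
    dsimp only
    rw [h2]
    module

/-- Applying `ad g` to the known brackets shows that `[A 1, A (-1)]`, `[A 2, A 0]`, `[A 3, A 1]` are
one element `c`. Computing `[g, c]` from two of these forms and comparing with `ad c` applied to `[A
1, A 0] = 4g` gives `12[g, c] = 0`. Once `c` commutes with `g`, applying `ad c` to `[A 2, A 1] = 4g`
isolates `[A 3, A 2]`. -/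
lemma adjacent_step [CharZero F] (A : ℤ → L) (g : L)
    (hrec : ∀ n, ⁅g, A n⁆ = (2 : F) • A (n + 1) - (2 : F) • A (n - 1))
    (h0 : ⁅A 0, A (-1)⁆ = (4 : F) • g) (h1 : ⁅A 1, A 0⁆ = (4 : F) • g)
    (h2 : ⁅A 2, A 1⁆ = (4 : F) • g) : ⁅A 3, A 2⁆ = (4 : F) • g := by
  have D := shift_lie_lie A g (2 : F) 1 hrec
  have hg : ∀ c : F, ⁅g, c • g⁆ = 0 := fun c => by simp
  have e1 : ⁅A 2, A 0⁆ = ⁅A 1, A (-1)⁆ := by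
    have := D 1 0
    rw [h1, hg] at this
    norm_num at this
    linear_combination (norm := module) (-(1 / 2) : F) • this
  have e2 : ⁅A 3, A 1⁆ = ⁅A 2, A 0⁆ := by
    have := D 2 1
    rw [h2, hg] at this
    norm_num at this
    linear_combination (norm := module) (-(1 / 2) : F) • this
  set c := ⁅A 1, A (-1)⁆ with hc
  have c0 : ⁅c, A 0⁆ = (8 : F) • A 2 - (8 : F) • A (-2) := by
    have e3 : ⁅A (-1), A 0⁆ = -((4 : F) • g) := by rw [← h0, lie_skew]
    rw [hc, lie_lie, e3, h1]
    have i1 := hrec 1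
    have i2 := hrec (-1)
    norm_num at i1 i2
    rw [lie_neg, lie_smul, lie_smul, ← lie_skew _ g, ← lie_skew _ g, i1, i2]
    module
  have c1 : ⁅c, A 1⁆ = (8 : F) • A 3 - (8 : F) • A (-1) := by
    have e3 : ⁅A 0, A 1⁆ = -((4 : F) • g) := by rw [← h1, lie_skew]
    rw [← e1, lie_lie, e3, h2]
    have i1 := hrec 2
    have i2 := hrec 0
    norm_num at i1 i2
    rw [lie_neg, lie_smul, lie_smul, ← lie_skew _ g, ← lie_skew _ g, i1, i2]
    module
  have x1 := D 2 0
  have x2 := D 1 (-1)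
  rw [e1] at x1
  rw [← hc] at x2
  norm_num [h1, h2] at x1 x2
  have h0' : ⁅A (-1), A 0⁆ = -((4 : F) • g) := by rw [← h0, lie_skew]
  have h1' : ⁅A 0, A 1⁆ = -((4 : F) • g) := by rw [← h1, lie_skew]
  have h2' : ⁅A 1, A 2⁆ = -((4 : F) • g) := by rw [← h2, lie_skew]
  have x3 : ⁅c, (4 : F) • g⁆ = (8 : F) • (⁅A 3, A 0⁆ - ⁅A 1, A (-2)⁆) := by
    rw [← h1, leibniz_lie, c0, c1]
    simp only [sub_lie, lie_sub, lie_smul, smul_lie, h0', h2']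
    module
  have x0 : ⁅g, c⁆ = 0 := by
    rw [lie_smul, ← lie_skew] at x3
    have : (12 : F) • ⁅g, c⁆ = 0 := by
      rw [h0] at x2
      linear_combination (norm := module) (4 : F) • x1 + (4 : F) • x2 - x3
    exact (smul_eq_zero.1 this).resolve_left (by norm_num)
  have x0' : ⁅c, g⁆ = 0 := by rw [← lie_skew, x0, neg_zero]
  have c2 : ⁅c, A 2⁆ = (8 : F) • A 4 - (8 : F) • A 0 := by
    have i1 := hrec 1
    have i3 := hrec 3
    have i4 := hrec (-1)
    norm_num at i1 i3 i4
    have i5 : ⁅c, ⁅g, A 1⁆⁆ = ⁅g, ⁅c, A 1⁆⁆ := by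
      rw [leibniz_lie, x0', zero_lie, zero_add]
    rw [i1, c1] at i5
    simp only [lie_sub, lie_smul, c0, i3, i4] at i5
    linear_combination (norm := module) (2⁻¹ : F) • i5
  have y1 : ⁅c, ⁅A 2, A 1⁆⁆ = 0 := by rw [h2, lie_smul, x0', smul_zero]
  rw [leibniz_lie, c1, c2] at y1
  simp only [sub_lie, lie_sub, lie_smul, smul_lie, h1'] at y1
  have y2 := D 3 1
  rw [e2, e1, x0] at y2
  norm_num [h2] at y2
  have y3 : ⁅A 2, A 3⁆ = -⁅A 3, A 2⁆ := (lie_skew _ _).symm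
  rw [y3] at y1
  rw [x0] at x1
  linear_combination (norm := module) (-(1 / 16) : F) • y1 - (1 / 4 : F) • y2 - (1 / 4 : F) • x1

lemma adjacent_lie [CharZero F] (A : ℤ → L) (g : L)
    (hrec : ∀ n, ⁅g, A n⁆ = (2 : F) • A (n + 1) - (2 : F) • A (n - 1))
    (h0 : ⁅A 0, A (-1)⁆ = (4 : F) • g) (h1 : ⁅A 1, A 0⁆ = (4 : F) • g)
    (h2 : ⁅A 2, A 1⁆ = (4 : F) • g) (n : ℤ) : ⁅A (n + 1), A n⁆ = (4 : F) • g := by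
  suffices h : ∀ n : ℤ, ⁅A n, A (n - 1)⁆ = (4 : F) • g ∧ ⁅A (n + 1), A n⁆ = (4 : F) • g ∧
      ⁅A (n + 2), A (n + 1)⁆ = (4 : F) • g from (h n).2.1
  intro n
  induction n using Int.induction_on with
  | zero => simpa using ⟨h0, h1, h2⟩
  | succ n ih =>
    obtain ⟨i0, i1, i2⟩ := ih
    refine ⟨by simpa using i1, ?_, ?_⟩
    · rw [add_assoc]; exact i2
    · have := adjacent_step (F := F) (fun k => A (n + k)) g
        (fun k => by rw [hrec, add_assoc, add_sub_assoc]) (by simpa [← sub_eq_add_neg] using i0) (by simpa using i1) i2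
      rw [add_assoc, add_assoc]; exact this
  | pred n ih =>
    obtain ⟨i0, i1, i2⟩ := ih
    -- Reversing the index preserves the recurrence with `g` replaced by `-g`, so the downward step
    -- is the upward one reflected.
    have := adjacent_step (F := F) (fun k => A (-(n : ℤ) + 1 - k)) (-g)
        (fun k => by
          rw [neg_lie, hrec, show -(n : ℤ) + 1 - (k + 1) = -(n : ℤ) + 1 - k - 1 by ring,
            show -(n : ℤ) + 1 - (k - 1) = -(n : ℤ) + 1 - k + 1 by ring]; abel)
        (by rw [← lie_skew, smul_neg, ← i2]; ring_nf)
        (by rw [← lie_skew, smul_neg, ← i1]; ring_nf)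
        (by rw [← lie_skew, smul_neg, ← i0]; ring_nf)
    rw [← lie_skew, smul_neg, neg_inj] at this
    refine ⟨?_, ?_, ?_⟩
    · rw [← this]; ring_nf
    · rw [← i0]; ring_nf
    · rw [← i1]; ring_nf

/-- The abelian half `G_k = ¼[A_k, A_0]` of the Onsager algebra. -/
noncomputable def onsagerG (F : Type*) {L : Type*} [Field F] [LieRing L] [LieAlgebra F L]
    (A : ℤ → L) (k : ℤ) : L := (4⁻¹ : F) • ⁅A k, A 0⁆

/-- The three claims feed each other: `ad g` applied to distance `k + 1` gives translation
invariance at distance `k + 2`, and Jacobi then gives the action of `G (k + 2)` on `A`. Commutation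
with `g` is the delicate claim. -/
lemma onsager_induction [CharZero F] (A : ℤ → L) (g : L)
    (hrec : ∀ n, ⁅g, A n⁆ = (2 : F) • A (n + 1) - (2 : F) • A (n - 1))
    (hadj : ∀ n, ⁅A (n + 1), A n⁆ = (4 : F) • g) (k : ℕ) :
    ((∀ m, ⁅A (m + k), A m⁆ = (4 : F) • onsagerG F A k) ∧
      (∀ l, ⁅onsagerG F A k, A l⁆ = (2 : F) • A (l + k) - (2 : F) • A (l - k)) ∧
      ⁅g, onsagerG F A k⁆ = 0) := by
  have D := shift_lie_lie A g (2 : F) 1 hrec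
  have hskew : ∀ m n, ⁅A m, A n⁆ = -⁅A n, A m⁆ := fun m n => (lie_skew _ _).symm
  induction k using Nat.twoStepInduction with
  | zero => simp [onsagerG]
  | one =>
    have hG : onsagerG F A 1 = g := by
      have := hadj 0
      rw [zero_add] at this
      rw [onsagerG, this]; module
    rw [Nat.cast_one, hG]
    exact ⟨hadj, hrec, lie_self _⟩
  | more k ih0 ih1 =>
    obtain ⟨p0, -, -⟩ := ih0
    obtain ⟨p1, q1, r1⟩ := ih1
    push_cast at p1 q1 r1 ⊢
    have s1 : ∀ m, ⁅A (m + (k + 2)), A m⁆ = ⁅A (m - 1 + (k + 2)), A (m - 1)⁆ := fun m => by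
      have := D (m + (k + 1)) m
      rw [p1, lie_smul, r1, show m + ((k : ℤ) + 1) - 1 = m + k by ring,
        show m + ((k : ℤ) + 1) + 1 = m + (k + 2) by ring, p0] at this
      have e := p0 (m + 1)
      rw [show m + 1 + (k : ℤ) = m + (k + 1) by ring] at e
      rw [e] at this
      rw [show m - 1 + ((k : ℤ) + 2) = m + (k + 1) by ring]
      linear_combination (norm := module) (-(1 / 2) : F) • this
    have s2 : ∀ m, ⁅A (m + (k + 2)), A m⁆ = ⁅A (k + 2), A 0⁆ := fun m => by
      induction m using Int.induction_on with
      | zero => rw [zero_add]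
      | succ m ih => rw [s1, add_sub_cancel_right, ih]
      | pred m ih => rw [← s1, ih]
    have s3 : ∀ m, ⁅A (m + (k + 2)), A m⁆ = (4 : F) • onsagerG F A (k + 2) := fun m => by
      rw [s2, onsagerG]; module
    have s4 : ∀ l, ⁅onsagerG F A (k + 2), A l⁆
        = (2 : F) • A (l + (k + 2)) - (2 : F) • A (l - (k + 2)) := fun l => by
      have e1 := s3 (l - 1)
      have e2 := hadj (l - 1)
      rw [sub_add_cancel] at e2
      have e3 : ⁅⁅A (l - 1 + (k + 2)), A (l - 1)⁆, A l⁆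
          = (4 : F) • ⁅g, A (l + (k + 1))⁆ + (4 : F) • ⁅onsagerG F A (k + 1), A (l - 1)⁆ := by
        rw [lie_lie, hskew (l - 1) l, e2, show l - 1 + ((k : ℤ) + 2) = l + (k + 1) by ring, p1,
          lie_neg, lie_smul, lie_smul, ← lie_skew g, ← lie_skew (onsagerG F A (k + 1))]
        module
      rw [e1, smul_lie, hrec, q1, show l + ((k : ℤ) + 1) + 1 = l + (k + 2) by ring,
        show l + ((k : ℤ) + 1) - 1 = l + k by ring,
        show l - 1 + ((k : ℤ) + 1) = l + k by ring,
        show l - 1 - ((k : ℤ) + 1) = l - (k + 2) by ring] at e3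
      linear_combination (norm := module) (1 / 4 : F) • e3
    refine ⟨s3, s4, ?_⟩
    -- `Y` measures the failure of translation invariance at distance `k + 3`: each unit shift costs
    -- `2Y`. Summing `k + 2` shifts and comparing with `ad G (k + 2)` applied to `[A 1, A 0] = 4g`
    -- gives `(k + 3)Y = 0`.
    set Y := ⁅g, onsagerG F A (k + 2)⁆ with hY
    have t1 : ∀ m, ⁅A (m + (k + 3)), A m⁆
        = ⁅A (m - 1 + (k + 3)), A (m - 1)⁆ + (2 : F) • Y := fun m => by
      have := D (m + (k + 2)) m
      have e := p1 (m + 1)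
      rw [show m + 1 + ((k : ℤ) + 1) = m + (k + 2) by ring] at e
      rw [s3, lie_smul, ← hY, show m + ((k : ℤ) + 2) - 1 = m + (k + 1) by ring,
        show m + ((k : ℤ) + 2) + 1 = m + (k + 3) by ring, p1, e] at this
      rw [show m - 1 + ((k : ℤ) + 3) = m + (k + 2) by ring]
      linear_combination (norm := module) (-(1 / 2) : F) • this
    have t2 : ∀ j : ℕ, ⁅A (0 + (k + 3)), A 0⁆
        = ⁅A (-(j : ℤ) + (k + 3)), A (-(j : ℤ))⁆ + (2 * j : F) • Y := fun j => by
      induction j with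
      | zero => simp
      | succ j ih =>
        rw [ih, t1, show -((j + 1 : ℕ) : ℤ) = -(j : ℤ) - 1 by push_cast; ring]
        push_cast
        module
    have t3 := shift_lie_lie A _ (2 : F) (k + 2) s4 1 0
    have t4 := t2 (k + 2)
    have e1 := hadj 0
    have e2 := p1 1
    have e3 := p1 (-(k + 1))
    rw [zero_add] at e1
    rw [show (1 : ℤ) + (k + 1) = k + 2 by ring] at e2
    rw [neg_add_cancel] at e3
    rw [e1, lie_smul, ← lie_skew, ← hY, zero_add, zero_sub, hskew 1 (k + 2), e2,
      show (1 : ℤ) - (k + 2) = -(k + 1) by ring, hskew (-((k : ℤ) + 1)) 0, e3,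
      show (1 : ℤ) + (k + 2) = 0 + (k + 3) by ring] at t3
    push_cast at t4
    rw [show -((k : ℤ) + 2) + (k + 3) = 1 by ring] at t4
    have t5 : ((k : F) + 3) • Y = 0 := by
      linear_combination (norm := module) (-(1 / 4) : F) • t3 - (1 / 2 : F) • t4
    refine (smul_eq_zero.1 t5).resolve_left ?_
    exact_mod_cast (Nat.succ_ne_zero (k + 2))

/-- The Dolan–Grady relations for a pair of elements of a Lie algebra. -/
structure DolanGrady (F : Type*) {L : Type*} [Field F] [LieRing L] [LieAlgebra F L]
    (u v : L) : Prop where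
  left : ⁅u, ⁅u, ⁅u, v⁆⁆⁆ = (4 : F) • ⁅u, v⁆
  right : ⁅v, ⁅v, ⁅v, u⁆⁆⁆ = (4 : F) • ⁅v, u⁆

/-- The Dolan–Grady relations imply Onsager's relations. -/
theorem DolanGrady.exists_onsager_seq [CharZero F] {u v : L} (huv : DolanGrady F u v) :
    ∃ A G : ℤ → L, A 0 = (2 : F) • u ∧ A 1 = (2 : F) • v ∧ G 1 = ⁅v, u⁆ ∧
      (∀ k, G (-k) = -G k) ∧
      (∀ m n, ⁅A m, A n⁆ = (4 : F) • G (m - n)) ∧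
      (∀ k l, ⁅G k, A l⁆ = (2 : F) • A (l + k) - (2 : F) • A (l - k)) ∧
      (∀ k l, ⁅G k, G l⁆ = 0) := by
  obtain ⟨huv, hvu⟩ := huv
  obtain ⟨A, hA0, hA1, hrec⟩ := exists_recurrent_seq (F := F) ⁅v, u⁆ ((2 : F) • u) ((2 : F) • v)
  have h1 : ⁅A 1, A 0⁆ = (4 : F) • ⁅v, u⁆ := by
    rw [hA0, hA1, smul_lie, lie_smul]; module
  have hs : ⁅u, v⁆ = -⁅v, u⁆ := (lie_skew _ _).symm
  have hadj : ∀ n, ⁅A (n + 1), A n⁆ = (4 : F) • ⁅v, u⁆ := by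
    refine adjacent_lie A _ hrec ?_ h1 ?_
    -- The two outer adjacent brackets are the two Dolan–Grady relations in disguise.
    · have e : (2 : F) • A (-1) = (2 : F) • A 1 - ⁅⁅v, u⁆, A 0⁆ := by
        rw [hrec]; simp
      have e2 : (2 : F) • ⁅A 0, A (-1)⁆ = (8 : F) • ⁅v, u⁆ := by
        rw [← lie_smul, e, lie_sub, lie_smul, ← lie_skew (A 0), h1, hA0, ← lie_skew ⁅v, u⁆]
        simp only [smul_lie, lie_smul, lie_neg, hs, smul_neg] at huv ⊢
        linear_combination (norm := module) (-4 : F) • huv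
      linear_combination (norm := module) (1 / 2 : F) • e2
    · have e : (2 : F) • A 2 = (2 : F) • A 0 + ⁅⁅v, u⁆, A 1⁆ := by
        rw [hrec]; norm_num
      have e2 : (2 : F) • ⁅A 2, A 1⁆ = (8 : F) • ⁅v, u⁆ := by
        rw [← smul_lie, e, add_lie, smul_lie, ← lie_skew (A 0), h1, hA1, ← lie_skew _ ((2 : F) • v),
          ← lie_skew ⁅v, u⁆]
        simp only [smul_lie, lie_smul, lie_neg] at hvu ⊢
        linear_combination (norm := module) (4 : F) • hvu
      linear_combination (norm := module) (1 / 2 : F) • e2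
  have ind := onsager_induction A _ hrec hadj
  have hskew : ∀ m n, ⁅A m, A n⁆ = -⁅A n, A m⁆ := fun m n => (lie_skew _ _).symm
  have hneg : ∀ k, onsagerG F A (-k) = -onsagerG F A k := by
    have : ∀ k : ℕ, onsagerG F A (-k) = -onsagerG F A k := fun k => by
      have := (ind k).1 (-k)
      rw [neg_add_cancel, hskew] at this
      rw [onsagerG]
      linear_combination (norm := module) (-(1 / 4) : F) • this
    intro k
    obtain ⟨n, rfl | rfl⟩ := Int.eq_nat_or_neg k
    · exact this n
    · rw [neg_neg, this, neg_neg]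
  have hAA : ∀ m n, ⁅A m, A n⁆ = (4 : F) • onsagerG F A (m - n) := by
    intro m n
    obtain ⟨k, hk | hk⟩ := Int.eq_nat_or_neg (m - n)
    · rw [hk, ← (ind k).1 n, ← hk]; congr 2; ring
    · rw [hk, hneg, smul_neg, ← (ind k).1 m, hskew]
      congr 3
      omega
  have hGA : ∀ k l, ⁅onsagerG F A k, A l⁆ = (2 : F) • A (l + k) - (2 : F) • A (l - k) := by
    intro k l
    obtain ⟨n, rfl | rfl⟩ := Int.eq_nat_or_neg k
    · exact (ind n).2.1 l
    · rw [hneg, neg_lie, (ind n).2.1, sub_neg_eq_add, ← sub_eq_add_neg]; abel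
  refine ⟨A, onsagerG F A, hA0, hA1, ?_, hneg, hAA, hGA, fun k l => ?_⟩
  · rw [onsagerG, h1]; module
  -- Expanding `G l` as a bracket, the derivation `ad (G k)` yields terms `G (l ± k)` that cancel in
  -- pairs.
  · conv_lhs => rw [show onsagerG F A l = (4⁻¹ : F) • ⁅A l, A 0⁆ from rfl]
    rw [lie_smul, shift_lie_lie A _ _ k (hGA k)]
    simp only [hAA]
    have e := hneg (l - k)
    rw [show -(l - k) = k - l by ring] at e
    rw [sub_zero, sub_zero, zero_add, zero_sub, sub_neg_eq_add]
    module

end OnsagerRelations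

end Tetrahedron

namespace Tetrahedron

/-! ### The multiplication table and spanning. -/

section AltBracket

variable {F L : Type*} [Field F] [LieRing L] [LieAlgebra F L]

lemma altBracket_odd (u v : L) (i : ℕ) :
    altBracket u v (2 * i + 1) = ⁅v, altBracket u v (2 * i)⁆ := by
  rw [altBracket, if_pos (even_two_mul i)]

lemma altBracket_even (u v : L) (i : ℕ) :
    altBracket u v (2 * i + 2) = ⁅u, altBracket u v (2 * i + 1)⁆ := by
  rw [altBracket, if_neg (by simp)]

lemma altBracket_one (u v : L) : altBracket u v 1 = ⁅v, u⁆ := altBracket_odd u v 0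

lemma altBracket_odd_succ (u v : L) (i : ℕ) :
    altBracket u v (2 * (i + 1) + 1) = ⁅v, ⁅u, altBracket u v (2 * i + 1)⁆⁆ := by
  rw [altBracket_odd, mul_add, altBracket_even]

namespace DolanGrady

lemma symm {u v : L} (h : DolanGrady F u v) : DolanGrady F v u := ⟨h.right, h.left⟩

variable [CharZero F] {u v : L}

/-- The odd iterated brackets lie in an abelian subspace on which `(ad u)² = (ad v)² = 4` and
`ad u`, `ad v` commute. -/
lemma exists_abelian_submodule (h : DolanGrady F u v) : ∃ S : Submodule F L,
    (∀ i, altBracket u v (2 * i + 1) ∈ S) ∧ (∀ x ∈ S, ∀ y ∈ S, ⁅x, y⁆ = 0) ∧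
    (∀ x ∈ S, ⁅u, ⁅v, x⁆⁆ = ⁅v, ⁅u, x⁆⁆) ∧
    (∀ x ∈ S, ⁅u, ⁅u, x⁆⁆ = (4 : F) • x) ∧ (∀ x ∈ S, ⁅v, ⁅v, x⁆⁆ = (4 : F) • x) := by
  obtain ⟨A, G, hA0, hA1, hG1, hneg, hAA, hGA, hGG⟩ := h.exists_onsager_seq
  have hu : u = (1 / 2 : F) • A 0 := by rw [hA0]; module
  have hv : v = (1 / 2 : F) • A 1 := by rw [hA1]; module
  have huG : ∀ k, ⁅u, G k⁆ = A (-k) - A k := fun k => by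
    rw [← lie_skew, hu, lie_smul, hGA, zero_add, zero_sub]; module
  have hvG : ∀ k, ⁅v, G k⁆ = A (1 - k) - A (1 + k) := fun k => by
    rw [← lie_skew, hv, lie_smul, hGA]; module
  have huA : ∀ k, ⁅u, A k⁆ = (-2 : F) • G k := fun k => by
    rw [hu, smul_lie, hAA, zero_sub, hneg]; module
  have hvA : ∀ k, ⁅v, A k⁆ = (2 : F) • G (1 - k) := fun k => by
    rw [hv, smul_lie, hAA]; module
  have hvuG : ∀ k, ⁅v, ⁅u, G k⁆⁆ = (2 : F) • G (k + 1) + (2 : F) • G (k - 1) := fun k => by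
    rw [huG, lie_sub, hvA, hvA, ← neg_sub k 1, hneg, sub_neg_eq_add, add_comm 1 k]; module
  have key : ∀ x ∈ Submodule.span F (Set.range G), ⁅v, ⁅u, x⁆⁆ ∈ Submodule.span F (Set.range G) ∧
      ⁅u, ⁅v, x⁆⁆ = ⁅v, ⁅u, x⁆⁆ ∧ ⁅u, ⁅u, x⁆⁆ = (4 : F) • x ∧ ⁅v, ⁅v, x⁆⁆ = (4 : F) • x := by
    intro x hx
    induction hx using Submodule.span_induction with
    | mem x hx =>
      obtain ⟨k, rfl⟩ := hx
      refine ⟨?_, ?_, ?_, ?_⟩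
      · rw [hvuG]
        exact add_mem (Submodule.smul_mem _ _ (Submodule.subset_span ⟨_, rfl⟩))
          (Submodule.smul_mem _ _ (Submodule.subset_span ⟨_, rfl⟩))
      · rw [hvuG, hvG, lie_sub, huA, huA, ← neg_sub k 1, hneg, add_comm 1 k]; module
      · rw [huG, lie_sub, huA, huA, hneg]; module
      · rw [hvG, lie_sub, hvA, hvA, sub_add_cancel_left, sub_sub_cancel, hneg]; module
    | zero => simp
    | add x y _ _ hx hy =>
      simp only [lie_add, smul_add, hx, hy]
      exact ⟨add_mem hx.1 hy.1, trivial, trivial, trivial⟩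
    | smul c x _ hx =>
      simp only [lie_smul, hx]
      exact ⟨Submodule.smul_mem _ _ hx.1, trivial, smul_comm _ _ _, smul_comm _ _ _⟩
  refine ⟨Submodule.span F (Set.range G), fun i => ?_, fun x hx y hy => ?_,
    fun x hx => (key x hx).2.1, fun x hx => (key x hx).2.2.1, fun x hx => (key x hx).2.2.2⟩
  · induction i with
    | zero => exact Submodule.subset_span ⟨1, by rw [hG1, mul_zero, zero_add, altBracket_one]⟩
    | succ i ih => rw [altBracket_odd_succ]; exact (key _ ih).1
  · induction hx, hy using Submodule.span_induction₂ with
    | mem_mem x y hx hy =>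
      obtain ⟨k, rfl⟩ := hx
      obtain ⟨l, rfl⟩ := hy
      exact hGG k l
    | zero_left => simp
    | zero_right => simp
    | add_left x y z _ _ _ hx hy => rw [add_lie, hx, hy, add_zero]
    | add_right x y z _ _ _ hx hy => rw [lie_add, hx, hy, add_zero]
    | smul_left c x y _ _ hx => rw [smul_lie, hx, smul_zero]
    | smul_right c x y _ _ hx => rw [lie_smul, hx, smul_zero]

lemma odd_lie_odd (h : DolanGrady F u v) (i j : ℕ) :
    ⁅altBracket u v (2 * i + 1), altBracket u v (2 * j + 1)⁆ = 0 := by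
  obtain ⟨S, hS, h0, -⟩ := h.exists_abelian_submodule
  exact h0 _ (hS i) _ (hS j)

lemma left_left_odd (h : DolanGrady F u v) (i : ℕ) :
    ⁅u, ⁅u, altBracket u v (2 * i + 1)⁆⁆ = (4 : F) • altBracket u v (2 * i + 1) := by
  obtain ⟨S, hS, -, -, h0, -⟩ := h.exists_abelian_submodule
  exact h0 _ (hS i)

lemma right_right_odd (h : DolanGrady F u v) (i : ℕ) :
    ⁅v, ⁅v, altBracket u v (2 * i + 1)⁆⁆ = (4 : F) • altBracket u v (2 * i + 1) := by
  obtain ⟨S, hS, -, -, -, h0⟩ := h.exists_abelian_submodule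
  exact h0 _ (hS i)

lemma left_right_odd (h : DolanGrady F u v) (i : ℕ) :
    ⁅u, ⁅v, altBracket u v (2 * i + 1)⁆⁆ = altBracket u v (2 * (i + 1) + 1) := by
  obtain ⟨S, hS, -, h0, -⟩ := h.exists_abelian_submodule
  rw [h0 _ (hS i), altBracket_odd_succ]

lemma altBracket_swap_odd (h : DolanGrady F u v) (i : ℕ) :
    altBracket v u (2 * i + 1) = -altBracket u v (2 * i + 1) := by
  induction i with
  | zero => rw [mul_zero, zero_add, altBracket_one, altBracket_one, lie_skew]
  | succ i ih => rw [altBracket_odd_succ, ih, ← h.left_right_odd, lie_neg, lie_neg]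

lemma altBracket_swap_even (h : DolanGrady F u v) (i : ℕ) :
    altBracket v u (2 * i + 2) = -⁅v, altBracket u v (2 * i + 1)⁆ := by
  rw [altBracket_even, h.altBracket_swap_odd, lie_neg]

/-- `[[z, x], y]` is symmetric in the odd iterated brackets `x`, `y`. -/
lemma lie_odd_lie_odd_comm (h : DolanGrady F u v) (z : L) (i j : ℕ) :
    ⁅⁅z, altBracket u v (2 * i + 1)⁆, altBracket u v (2 * j + 1)⁆
      = ⁅⁅z, altBracket u v (2 * j + 1)⁆, altBracket u v (2 * i + 1)⁆ := by
  rw [lie_lie, h.odd_lie_odd, lie_zero, zero_sub, lie_skew]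

lemma left_odd_lie_one (h : DolanGrady F u v) (i : ℕ) :
    ⁅⁅u, altBracket u v (2 * i + 1)⁆, altBracket u v 1⁆
      = altBracket u v (2 * i + 4) + (4 : F) • altBracket v u (2 * i + 2) := by
  rw [altBracket_one, leibniz_lie, ← lie_skew ⁅u, _⁆ v, ← lie_skew ⁅u, _⁆ u, h.left_left_odd,
    ← altBracket_odd_succ, neg_lie, lie_skew, h.altBracket_swap_even,
    show 2 * i + 4 = 2 * (i + 1) + 2 by ring, altBracket_even, lie_neg, lie_smul, smul_neg]

/-- By `left_odd_lie_one`, `[u, a_{2i+3}]` is a fixed combination of brackets `[z, a_{2i+1}]`, with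
`z = [u, a_1]` and `z = v`; bracketing these with `a_{2j+1}` is symmetric in `i` and `j`. -/
lemma left_odd_lie_odd_succ (h : DolanGrady F u v) (i j : ℕ) :
    ⁅⁅u, altBracket u v (2 * (i + 1) + 1)⁆, altBracket u v (2 * j + 1)⁆
      = ⁅⁅u, altBracket u v (2 * (j + 1) + 1)⁆, altBracket u v (2 * i + 1)⁆ := by
  have key : ∀ i, ⁅u, altBracket u v (2 * (i + 1) + 1)⁆
      = ⁅⁅u, altBracket u v 1⁆, altBracket u v (2 * i + 1)⁆
        + (4 : F) • ⁅v, altBracket u v (2 * i + 1)⁆ := fun i => by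
    have := h.lie_odd_lie_odd_comm u 0 i
    rw [mul_zero, zero_add] at this
    rw [this, h.left_odd_lie_one, h.altBracket_swap_even,
      show 2 * i + 4 = 2 * (i + 1) + 2 by ring, altBracket_even]
    module
  rw [key, key, add_lie, add_lie, smul_lie, smul_lie, h.lie_odd_lie_odd_comm _ i j,
    h.lie_odd_lie_odd_comm v i j]

lemma even_lie_odd (h : DolanGrady F u v) (i j : ℕ) :
    ⁅altBracket u v (2 * i + 2), altBracket u v (2 * j + 1)⁆
      = altBracket u v (2 * (i + j) + 4) + (4 : F) • altBracket v u (2 * (i + j) + 2) := by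
  rw [altBracket_even]
  induction j generalizing i with
  | zero => exact h.left_odd_lie_one i
  | succ j ih =>
    -- Two swaps move one unit from `j` to `i`, which is why `i` is generalized.
    rw [h.lie_odd_lie_odd_comm, h.left_odd_lie_odd_succ, ih, show i + 1 + j = i + (j + 1) by ring]

/-- The bracket equals `ad u` of an expression depending only on `i + j`, so it is both symmetric
and skew. -/
lemma even_lie_even (h : DolanGrady F u v) (i j : ℕ) :
    ⁅altBracket u v (2 * i + 2), altBracket u v (2 * j + 2)⁆ = 0 := by
  have key : ∀ i j, ⁅altBracket u v (2 * i + 2), altBracket u v (2 * j + 2)⁆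
      = ⁅u, ⁅altBracket u v (2 * i + 2), altBracket u v (2 * j + 1)⁆⁆ := fun i j => by
    rw [leibniz_lie u, altBracket_even u v i, h.left_left_odd, smul_lie, h.odd_lie_odd, smul_zero,
      zero_add, altBracket_even u v j]
  have e := key j i
  rw [h.even_lie_odd, add_comm j i, ← h.even_lie_odd, ← key, ← lie_skew] at e
  have : (2 : F) • ⁅altBracket u v (2 * i + 2), altBracket u v (2 * j + 2)⁆ = 0 := by
    linear_combination (norm := module) -e
  exact (smul_eq_zero.1 this).resolve_left two_ne_zero

lemma swap_even_lie_even (h : DolanGrady F u v) (i j : ℕ) :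
    ⁅altBracket v u (2 * i + 2), altBracket u v (2 * j + 2)⁆
      = altBracket u v (2 * (i + j) + 5) - (16 : F) • altBracket u v (2 * (i + j) + 1) := by
  -- `ad v` passes to the second factor, since `[v, a_{2j+2}]` is odd and commutes with `a_{2i+1}`.
  -- The 16 below is the 4 of `even_lie_odd` times the 4 of `(ad v)²`.
  have e : ⁅v, ⁅altBracket u v (2 * j + 2), altBracket u v (2 * i + 1)⁆⁆
      = ⁅altBracket u v (2 * j + 2), ⁅v, altBracket u v (2 * i + 1)⁆⁆ := by
    rw [leibniz_lie v, altBracket_even u v j, ← altBracket_odd_succ, h.odd_lie_odd, zero_add]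
  rw [h.altBracket_swap_even, neg_lie, lie_skew, ← e, h.even_lie_odd, lie_add, lie_smul,
    h.altBracket_swap_even, lie_neg, h.right_right_odd, add_comm j i,
    show 2 * (i + j) + 5 = 2 * (i + j + 2) + 1 by ring, altBracket_odd u v (i + j + 2),
    show 2 * (i + j + 2) = 2 * (i + j) + 4 by ring]
  module

lemma left_lie_even (h : DolanGrady F u v) (i : ℕ) :
    ⁅u, altBracket u v (2 * i + 2)⁆ = (4 : F) • altBracket u v (2 * i + 1) := by
  rw [altBracket_even, h.left_left_odd]

lemma swap_even_lie_left (h : DolanGrady F u v) (i : ℕ) :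
    ⁅altBracket v u (2 * i + 2), u⁆ = altBracket u v (2 * i + 3) := by
  rw [h.altBracket_swap_even, neg_lie, lie_skew, h.left_right_odd]
  rfl

end DolanGrady

/-- The family `a_{2i}, b_{2i}, a_{2i+1}` of a pair of elements. -/
def onsagerFamily {L : Type*} [LieRing L] (u v : L) : ℕ ⊕ ℕ ⊕ ℕ → L :=
  Sum.elim (fun i => altBracket u v (2 * i))
    (Sum.elim (fun i => altBracket v u (2 * i)) fun i => altBracket u v (2 * i + 1))

lemma map_altBracket {L L' : Type*} [LieRing L] [LieRing L'] [LieAlgebra F L] [LieAlgebra F L']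
    (f : L →ₗ⁅F⁆ L') (u v : L) (n : ℕ) : f (altBracket u v n) = altBracket (f u) (f v) n := by
  induction n with
  | zero => rfl
  | succ n ih => rw [altBracket, altBracket]; split_ifs <;> rw [LieHom.map_lie, ih]

lemma map_onsagerFamily {L L' : Type*} [LieRing L] [LieRing L'] [LieAlgebra F L] [LieAlgebra F L']
    (f : L →ₗ⁅F⁆ L') (u v : L) : f ∘ onsagerFamily u v = onsagerFamily (f u) (f v) := by
  funext i
  rcases i with i | i | i <;> exact map_altBracket f _ _ _

/-- The elements whose adjoint action preserves `S` form a subalgebra, so stability need only be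
tested on the two generators. -/
lemma lieSpan_pair_le {u v : L} {S : Submodule F L} (hu : u ∈ S) (hv : v ∈ S)
    (hSu : ∀ y ∈ S, ⁅u, y⁆ ∈ S) (hSv : ∀ y ∈ S, ⁅v, y⁆ ∈ S) :
    (LieSubalgebra.lieSpan F L {u, v}).toSubmodule ≤ S := by
  have hS : ∀ z ∈ LieSubalgebra.lieSpan F L {u, v}, ∀ y ∈ S, ⁅z, y⁆ ∈ S := by
    intro z hz
    induction hz using LieSubalgebra.lieSpan_induction with
    | mem z hz => rcases hz with rfl | rfl; exacts [hSu, hSv]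
    | zero => simp
    | add z w _ _ hz hw => exact fun y hy => by rw [add_lie]; exact add_mem (hz y hy) (hw y hy)
    | smul c z _ hz => exact fun y hy => by rw [smul_lie]; exact S.smul_mem _ (hz y hy)
    | lie z w _ _ hz hw =>
      exact fun y hy => by rw [lie_lie]; exact sub_mem (hz _ (hw y hy)) (hw _ (hz y hy))
  intro z hz
  induction hz using LieSubalgebra.lieSpan_induction with
  | mem z hz => rcases hz with rfl | rfl; exacts [hu, hv]
  | zero => exact S.zero_mem
  | add z w _ _ hz hw => exact add_mem hz hw
  | smul c z _ hz => exact S.smul_mem _ hz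
  | lie z w hz _ _ hw => exact hS z hz w hw

theorem DolanGrady.lieSpan_le_span [CharZero F] {u v : L} (h : DolanGrady F u v) :
    (LieSubalgebra.lieSpan F L {u, v}).toSubmodule
      ≤ Submodule.span F (Set.range (onsagerFamily u v)) := by
  set S := Submodule.span F (Set.range (onsagerFamily u v)) with hS
  have ha : ∀ i, altBracket u v (2 * i) ∈ S := fun i => Submodule.subset_span ⟨Sum.inl i, rfl⟩
  have hb : ∀ i, altBracket v u (2 * i) ∈ S := fun i =>
    Submodule.subset_span ⟨Sum.inr (Sum.inl i), rfl⟩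
  have hc : ∀ i, altBracket u v (2 * i + 1) ∈ S := fun i =>
    Submodule.subset_span ⟨Sum.inr (Sum.inr i), rfl⟩
  have stable : ∀ z : L, (∀ i, ⁅z, onsagerFamily u v i⁆ ∈ S) → ∀ y ∈ S, ⁅z, y⁆ ∈ S :=
    fun z hz y hy => by
      induction hy using Submodule.span_induction with
      | mem y hy => obtain ⟨i, rfl⟩ := hy; exact hz i
      | zero => simp
      | add x y _ _ hx hy => rw [lie_add]; exact add_mem hx hy
      | smul c x _ hx => rw [lie_smul]; exact S.smul_mem _ hx
  refine lieSpan_pair_le (ha 0) (hb 0) (stable u ?_) (stable v ?_)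
  · rintro ((_ | i) | i | i)
    · simp [onsagerFamily, altBracket]
    · change ⁅u, altBracket u v (2 * i + 2)⁆ ∈ S
      rw [h.left_lie_even]; exact S.smul_mem _ (hc i)
    · change ⁅u, altBracket v u (2 * i)⁆ ∈ S
      rw [← altBracket_odd, h.altBracket_swap_odd]; exact neg_mem (hc i)
    · change ⁅u, altBracket u v (2 * i + 1)⁆ ∈ S
      rw [← altBracket_even]; exact ha (i + 1)
  · rintro (i | (_ | i) | i)
    · change ⁅v, altBracket u v (2 * i)⁆ ∈ S
      rw [← altBracket_odd]; exact hc i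
    · simp [onsagerFamily, altBracket]
    · change ⁅v, altBracket v u (2 * i + 2)⁆ ∈ S
      rw [h.symm.left_lie_even, h.altBracket_swap_odd]; exact S.smul_mem _ (neg_mem (hc i))
    · change ⁅v, altBracket u v (2 * i + 1)⁆ ∈ S
      rw [← neg_mem_iff, ← h.altBracket_swap_even]; exact hb (i + 1)

end AltBracket

end Tetrahedron

namespace Tetrahedron

/-! ### A 2×2 matrix model and linear independence. -/

section Model

open Polynomial

attribute [local instance] LieRing.ofAssociativeRing

variable {F K : Type*} [Field F] [Field K] [Algebra F K]

/-- The traceless matrix with eigenvalue `-1` on `(1, p)` and `1` on `(1, q)`. -/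
noncomputable def pointMatrix (p q : K) : Matrix (Fin 2) (Fin 2) K :=
  (p - q)⁻¹ • !![p + q, -2; 2 * p * q, -(p + q)]

lemma pointMatrix_skew (p q : K) : pointMatrix p q + pointMatrix q p = 0 := by
  rw [pointMatrix, pointMatrix, ← neg_sub p q, inv_neg, neg_smul, add_comm q p,
    mul_right_comm 2 q p, add_neg_cancel]

lemma pointMatrix_mul_self {p q : K} (hpq : p ≠ q) : pointMatrix p q * pointMatrix p q = 1 := by
  have := sub_ne_zero.2 hpq
  ext i j
  fin_cases i <;> fin_cases j <;>
    simp [pointMatrix, Matrix.mul_apply, Fin.sum_univ_two] <;> field_simp <;> ring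

/-- The two matrices have eigenvalues `1` and `-1` on the common vector `(1, q)`. Their sum `N`
kills it and is traceless, so `N` is nilpotent with image in that line, whence `[P, N] = 2N` for the
first matrix `P`. -/
lemma pointMatrix_lie {p q r : K} (hpq : p ≠ q) (hqr : q ≠ r) :
    ⁅pointMatrix p q, pointMatrix q r⁆
      = (2 : F) • pointMatrix p q + (2 : F) • pointMatrix q r := by
  have h1 := sub_ne_zero.2 hpq
  have h2 := sub_ne_zero.2 hqr
  rw [LieRing.of_associative_ring_bracket, two_smul, two_smul]
  ext i j
  fin_cases i <;> fin_cases j <;>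
    simp [pointMatrix] <;> field_simp <;> ring

/-- `ad X` is the difference of two commuting involutions, left and right multiplication, so its
cube is 4 times itself. -/
lemma lie_lie_lie_of_mul_self {R : Type*} [Ring R] [Algebra F R] {X : R} (hX : X * X = 1) (Y : R) :
    ⁅X, ⁅X, ⁅X, Y⁆⁆⁆ = (4 : F) • ⁅X, Y⁆ := by
  have h1 : ∀ Z, X * (X * Z) = Z := fun Z => by rw [← mul_assoc, hX, one_mul]
  simp only [LieRing.of_associative_ring_bracket, mul_sub, sub_mul, mul_assoc, hX, h1, mul_one]
  module

/-- The representation of the tetrahedron algebra attached to four distinct elements of a field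
extension. -/
noncomputable def pointRep (m : Fin 4 → K) (hm : Function.Injective m) :
    Tet F →ₗ⁅F⁆ Matrix (Fin 2) (Fin 2) K :=
  let f : FreeLieAlgebra F Gen →ₗ⁅F⁆ Matrix (Fin 2) (Fin 2) K :=
    FreeLieAlgebra.lift F fun g : Gen => pointMatrix (m g.1.1) (m g.1.2)
  have hf : ∀ i j hij, f (freeX F i j hij) = pointMatrix (m i) (m j) := fun i j hij =>
    FreeLieAlgebra.lift_of_apply _ _
  have hle : relIdeal F ≤ f.ker := by
    refine LieSubmodule.lieSpan_le.2 fun r hr => ?_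
    change f r = 0
    induction hr with
    | skew i j hij => rw [map_add, hf, hf, pointMatrix_skew]
    | triple h i j hhi hij hhj =>
      rw [map_sub, map_add, map_smul, map_smul, LieHom.map_lie, hf, hf,
        pointMatrix_lie (F := F) (hm.ne hhi) (hm.ne hij), sub_self]
    | dolanGrady h i j k hhi hhj hhk hij hik hjk =>
      rw [map_sub, map_smul, LieHom.map_lie, LieHom.map_lie, LieHom.map_lie, hf, hf,
        lie_lie_lie_of_mul_self (F := F) (pointMatrix_mul_self (hm.ne hhi)), sub_self]
  { (relIdeal F).toSubmodule.liftQ (f : FreeLieAlgebra F Gen →ₗ[F] Matrix (Fin 2) (Fin 2) K)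
      fun _ hr => hle hr with
    map_lie' := fun {a b} => by
      induction a using Submodule.Quotient.induction_on
      induction b using Submodule.Quotient.induction_on
      exact LieHom.map_lie f _ _ }

lemma pointRep_x (m : Fin 4 → K) (hm : Function.Injective m) (i j : Fin 4) (hij : i ≠ j) :
    pointRep (F := F) m hm (x F i j hij) = pointMatrix (m i) (m j) :=
  FreeLieAlgebra.lift_of_apply _ _

/-- Four points whose cross-ratio is a parameter `s`. -/
noncomputable def crossPoints (s : K) : Fin 4 → K := ![0, 1, -1, -4 * s⁻¹]

lemma crossPoints_injective [CharZero K] {s : K} (h0 : s ≠ 0) (h1 : s ≠ 4) (h2 : s ≠ -4) :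
    Function.Injective (crossPoints s) := by
  have e1 : -4 * s⁻¹ ≠ 0 := by simp [h0]
  have e2 : -4 * s⁻¹ ≠ 1 := fun h => h2 (by field_simp at h; exact h.symm)
  have e3 : -4 * s⁻¹ ≠ -1 := fun h => h1 (by field_simp at h; exact (neg_inj.1 h).symm)
  have e4 : (1 : K) ≠ -1 := by norm_num
  intro i j hij
  fin_cases i <;> fin_cases j <;> simp_all [crossPoints, eq_comm]

lemma pointMatrix_crossPoints_left [CharZero K] (s : K) :
    pointMatrix (crossPoints s 1) (crossPoints s 2) = !![0, -1; -1, 0] := by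
  ext i j
  fin_cases i <;> fin_cases j <;> simp [pointMatrix, crossPoints] <;> norm_num

lemma pointMatrix_crossPoints_right [CharZero K] {s : K} (h0 : s ≠ 0) :
    pointMatrix (crossPoints s 0) (crossPoints s 3) = !![-1, -s / 2; 0, 1] := by
  ext i j
  fin_cases i <;> fin_cases j <;> simp [pointMatrix, crossPoints] <;> field_simp
  norm_num

section PolynomialModel

variable {L : Type*} [LieRing L] [LieAlgebra K L] {U V : L} {s : K}

lemma altBracket_odd_of_lie (h : ⁅U, ⁅V, U⁆⁆ = s • U - (4 : K) • V) (i : ℕ) :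
    altBracket U V (2 * i + 1) = s ^ i • ⁅V, U⁆ := by
  induction i with
  | zero => rw [mul_zero, zero_add, altBracket_one, pow_zero, one_smul]
  | succ i ih =>
    rw [altBracket_odd_succ, ih, lie_smul, h, lie_smul, lie_sub, lie_smul, lie_smul, lie_self]
    module

lemma altBracket_even_of_lie (h : ⁅U, ⁅V, U⁆⁆ = s • U - (4 : K) • V) (i : ℕ) :
    altBracket U V (2 * i + 2) = s ^ i • (s • U - (4 : K) • V) := by
  rw [altBracket_even, altBracket_odd_of_lie h, lie_smul, h]

variable [LieAlgebra F L] [IsScalarTower F K L]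

/-- The triple `(c, d, e)` sent to the corresponding combination of the family
`onsagerFamily U V`, when `ad V ad U` acts on the odd brackets as multiplication by `s`. -/
noncomputable def polyCombination (s : K) (U V : L) : F[X] × F[X] × F[X] →ₗ[F] L where
  -- Modelled on `a_{2i+2} = s^{i+1} U - 4 s^i V`: `divX` lowers the exponent by one. The case `a_0
  -- = U` fits because `divX 1 = 0`.
  toFun q := aeval s (q.1 - C 4 * divX q.2.1) • U + aeval s (q.2.1 - C 4 * divX q.1) • V
    + aeval s q.2.2 • ⁅V, U⁆
  map_add' q r := by
    simp only [Prod.fst_add, Prod.snd_add, divX_add, map_add, map_sub, map_mul]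
    module
  map_smul' c q := by
    simp only [Prod.smul_fst, Prod.smul_snd, smul_eq_C_mul, divX_C_mul, map_sub, map_mul, smul_add,
      RingHom.id_apply, aeval_C, ← algebraMap_smul K c]
    module

lemma polyCombination_apply (q : F[X] × F[X] × F[X]) : polyCombination s U V q =
    aeval s (q.1 - C 4 * divX q.2.1) • U + aeval s (q.2.1 - C 4 * divX q.1) • V
      + aeval s q.2.2 • ⁅V, U⁆ := rfl

lemma polyCombination_comp_basis (h1 : ⁅U, ⁅V, U⁆⁆ = s • U - (4 : K) • V)
    (h2 : ⁅V, ⁅U, V⁆⁆ = s • V - (4 : K) • U) :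
    polyCombination (F := F) s U V ∘
      ((basisMonomials F).prod ((basisMonomials F).prod (basisMonomials F))) =
      onsagerFamily U V := by
  funext i
  rcases i with i | i | i
  · rcases i with _ | i
    · simp [polyCombination_apply, onsagerFamily, altBracket]
    · simp [polyCombination_apply, onsagerFamily, mul_add, altBracket_even_of_lie h1,
        ← X_pow_eq_monomial, divX_X_pow]
      rw [map_ofNat (algebraMap F K) 4]
      module
  · rcases i with _ | i
    · simp [polyCombination_apply, onsagerFamily, altBracket]
    · simp [polyCombination_apply, onsagerFamily, mul_add, altBracket_even_of_lie h2,
        ← X_pow_eq_monomial, divX_X_pow]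
      rw [map_ofNat (algebraMap F K) 4]
      module
  · simp [polyCombination_apply, onsagerFamily, altBracket_odd_of_lie h1, ← X_pow_eq_monomial]

/-- `divX` strictly lowers the degree of a nonzero polynomial, so each of `c`, `d` would have
smaller degree than the other. -/
lemma eq_zero_of_eq_divX {c d : F[X]} {r : F} (hc : c = C r * divX d) (hd : d = C r * divX c) :
    c = 0 := by
  by_contra h
  have h1 : d ≠ 0 := fun h0 => h (by rw [hc, h0, divX_zero, mul_zero])
  have h2 : ∀ p : F[X], (C r * p).degree ≤ p.degree := fun p => by
    rw [← smul_eq_C_mul]; exact degree_smul_le r p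
  have e1 : c.degree < d.degree := by
    conv_lhs => rw [hc]
    exact (h2 _).trans_lt (degree_divX_lt h1)
  have e2 : d.degree < c.degree := by
    conv_lhs => rw [hd]
    exact (h2 _).trans_lt (degree_divX_lt h)
  exact lt_asymm e1 e2

theorem linearIndependent_onsagerFamily (hs : Transcendental F s)
    (h1 : ⁅U, ⁅V, U⁆⁆ = s • U - (4 : K) • V) (h2 : ⁅V, ⁅U, V⁆⁆ = s • V - (4 : K) • U)
    (hli : ∀ α β γ : K, α • U + β • V + γ • ⁅V, U⁆ = 0 → α = 0 ∧ β = 0 ∧ γ = 0) :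
    LinearIndependent F (onsagerFamily U V) := by
  rw [← polyCombination_comp_basis (F := F) h1 h2]
  refine (Module.Basis.linearIndependent _).map' _ (LinearMap.ker_eq_bot'.2 fun q hq => ?_)
  obtain ⟨hc, hd, he⟩ := hli _ _ _ hq
  have inj : ∀ p : F[X], aeval s p = 0 → p = 0 := transcendental_iff.1 hs
  have hc' := sub_eq_zero.1 (inj _ hc)
  have hd' := sub_eq_zero.1 (inj _ hd)
  exact Prod.ext (eq_zero_of_eq_divX hc' hd') (Prod.ext (eq_zero_of_eq_divX hd' hc') (inj _ he))

end PolynomialModel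

/-- The double bracket is `2UVU - 2V`, and the anticommutator gives `UVU = (s/2)U - V`. The point
`-4/s` in `crossPoints` makes the anticommutator exactly `s/2`. -/
lemma lie_lie_of_mul_self [CharZero K] {R : Type*} [Ring R] [Algebra K R] {U V : R} {s : K}
    (hU : U * U = 1) (hUV : U * V + V * U = (s / 2) • (1 : R)) :
    ⁅U, ⁅V, U⁆⁆ = s • U - (4 : K) • V := by
  have e : U * V = (s / 2) • (1 : R) - V * U := eq_sub_of_add_eq hUV
  simp only [LieRing.of_associative_ring_bracket, mul_sub, sub_mul, ← mul_assoc, hU]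
  simp only [e, mul_assoc, hU, sub_mul, smul_mul_assoc, one_mul, mul_one]
  module

theorem linearIndependent_crossPoints [CharZero F] {s : K} (hs : Transcendental F s) :
    LinearIndependent F (onsagerFamily (pointMatrix (crossPoints s 1) (crossPoints s 2))
      (pointMatrix (crossPoints s 0) (crossPoints s 3))) := by
  have : CharZero K := charZero_of_injective_algebraMap (algebraMap F K).injective
  have h0 : s ≠ 0 := fun h => hs (h ▸ isAlgebraic_zero)
  have h16 : s ^ 2 - 16 ≠ 0 := fun h =>
    hs ⟨X ^ 2 - C 16, X_pow_sub_C_ne_zero two_pos _, by simpa [map_ofNat (algebraMap F K) 16] using h⟩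
  rw [pointMatrix_crossPoints_left, pointMatrix_crossPoints_right h0]
  set U : Matrix (Fin 2) (Fin 2) K := !![0, -1; -1, 0] with hU
  set V : Matrix (Fin 2) (Fin 2) K := !![-1, -s / 2; 0, 1] with hV
  have hUU : U * U = 1 := by rw [hU, Matrix.one_fin_two]; simp
  have hVV : V * V = 1 := by rw [hV, Matrix.one_fin_two]; simp
  have hUV : U * V + V * U = (s / 2) • (1 : Matrix (Fin 2) (Fin 2) K) := by
    rw [hU, hV, Matrix.one_fin_two]; simp [neg_div]
  refine linearIndependent_onsagerFamily hs (lie_lie_of_mul_self hUU hUV)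
    (lie_lie_of_mul_self hVV (by rw [add_comm]; exact hUV)) fun α β γ h => ?_
  have hg : ⁅V, U⁆ = !![s / 2, 2; -2, -(s / 2)] := by
    rw [LieRing.of_associative_ring_bracket, hU, hV]
    simp [neg_div]
    norm_num
  rw [hg, hU, hV] at h
  have e00 := congr_fun (congr_fun h 0) 0
  have e01 := congr_fun (congr_fun h 0) 1
  have e10 := congr_fun (congr_fun h 1) 0
  simp at e00 e01 e10
  have hγ : γ = 0 := by
    refine (mul_eq_zero.1 (?_ : (s ^ 2 - 16) * γ = 0)).resolve_left h16
    -- This combination eliminates `α` and `β`; the factor `s² - 16` left over is nonzero because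
    -- `s` is transcendental.
    linear_combination 2 * s * e00 - 4 * e01 + 4 * e10
  subst hγ
  simp at e00 e10
  exact ⟨e10, e00, rfl⟩

end Model

end Tetrahedron

/-! ### Transfer to the Onsager subalgebra. -/

namespace Tetrahedron

variable (F : Type*) [Field F]

lemma dolanGrady_x : DolanGrady F (x F 1 2 (by decide)) (x F 0 3 (by decide)) := by
  have key : ∀ h i j k (hhi : h ≠ i) (hhj : h ≠ j) (hhk : h ≠ k)
      (hij : i ≠ j) (hik : i ≠ k) (hjk : j ≠ k),
      ⁅x F h i hhi, ⁅x F h i hhi, ⁅x F h i hhi, x F j k hjk⁆⁆⁆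
        = (4 : F) • ⁅x F h i hhi, x F j k hjk⁆ := fun h i j k hhi hhj hhk hij hik hjk =>
    (Submodule.Quotient.eq (relIdeal F).toSubmodule).2 <|
      LieSubmodule.subset_lieSpan (Relator.dolanGrady h i j k hhi hhj hhk hij hik hjk)
  constructor
  · exact key 1 2 0 3 (by decide) (by decide) (by decide) (by decide) (by decide) (by decide)
  · exact key 0 3 1 2 (by decide) (by decide) (by decide) (by decide) (by decide) (by decide)

lemma dolanGrady_ox : DolanGrady F (ox12 F) (ox03 F) :=
  ⟨Subtype.ext (dolanGrady_x F).left, Subtype.ext (dolanGrady_x F).right⟩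

variable [CharZero F]

lemma span_onsagerFamily_ox :
    ⊤ ≤ Submodule.span F (Set.range (onsagerFamily (ox12 F) (ox03 F))) := by
  rintro z -
  have hz := (dolanGrady_x F).lieSpan_le_span z.2
  have e : onsagerFamily (x F 1 2 (by decide)) (x F 0 3 (by decide))
      = (Onsager F).incl ∘ onsagerFamily (ox12 F) (ox03 F) :=
    (map_onsagerFamily (Onsager F).incl (ox12 F) (ox03 F)).symm
  rw [e, Set.range_comp] at hz
  obtain ⟨w, hw, hwz⟩ := Submodule.span_image (Onsager F).toSubmodule.subtype ▸ hz
  rwa [← Subtype.ext hwz]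

section Independence

attribute [local instance] LieRing.ofAssociativeRing

lemma linearIndependent_onsagerFamily_ox :
    LinearIndependent F (onsagerFamily (ox12 F) (ox03 F)) := by
  have hX : Transcendental F (RatFunc.X : RatFunc F) := RatFunc.transcendental_X
  have hne : ∀ c : F, (RatFunc.X : RatFunc F) ≠ algebraMap F _ c := fun c h =>
    hX (h ▸ isAlgebraic_algebraMap c)
  have : CharZero (RatFunc F) :=
    charZero_of_injective_algebraMap (algebraMap F (RatFunc F)).injective
  have hm : Function.Injective (crossPoints (RatFunc.X : RatFunc F)) :=
    crossPoints_injective (by simpa using hne 0)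
      (by simpa only [map_ofNat] using hne 4) (by simpa only [map_neg, map_ofNat] using hne (-4))
  let φ := (pointRep (F := F) _ hm).comp (Onsager F).incl
  refine LinearIndependent.of_comp (φ : Onsager F →ₗ[F] Matrix (Fin 2) (Fin 2) (RatFunc F)) ?_
  have h := linearIndependent_crossPoints (F := F) hX
  rw [← pointRep_x (F := F) _ hm 1 2 (by decide), ← pointRep_x (F := F) _ hm 0 3 (by decide)] at h
  exact (map_onsagerFamily φ (ox12 F) (ox03 F)) ▸ h

end Independence

end Tetrahedron

theorem mainTheorem3 (F : Type*) [Field F] [CharZero F] :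
    (∃ B : Module.Basis (ℕ ⊕ ℕ ⊕ ℕ) F (Tetrahedron.Onsager F),
      (∀ i : ℕ, B (Sum.inl i) = Tetrahedron.a F (2 * i)) ∧
      (∀ i : ℕ, B (Sum.inr (Sum.inl i)) = Tetrahedron.b F (2 * i)) ∧
      (∀ i : ℕ, B (Sum.inr (Sum.inr i)) = Tetrahedron.a F (2 * i + 1))) ∧
    -- the bracket of `a_{2i}` and `a_{2j}`
    (∀ i j : ℕ, (i = 0 ∧ j = 0) ∨ (1 ≤ i ∧ 1 ≤ j) →
      ⁅Tetrahedron.a F (2 * i), Tetrahedron.a F (2 * j)⁆ = 0) ∧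
    (∀ j : ℕ, 1 ≤ j →
      ⁅Tetrahedron.a F 0, Tetrahedron.a F (2 * j)⁆ = (4 : F) • Tetrahedron.a F (2 * j - 1)) ∧
    -- the bracket of `b_{2i}` and `a_{2j}`
    (∀ i : ℕ,
      ⁅Tetrahedron.b F (2 * i), Tetrahedron.a F 0⁆ = Tetrahedron.a F (2 * i + 1)) ∧
    (∀ j : ℕ, 1 ≤ j →
      ⁅Tetrahedron.b F 0, Tetrahedron.a F (2 * j)⁆ = Tetrahedron.a F (2 * j + 1)) ∧
    (∀ i j : ℕ, 1 ≤ i → 1 ≤ j →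
      ⁅Tetrahedron.b F (2 * i), Tetrahedron.a F (2 * j)⁆ =
        Tetrahedron.a F (2 * i + 2 * j + 1) - (16 : F) • Tetrahedron.a F (2 * i + 2 * j - 3)) ∧
    -- the bracket of `b_{2i}` and `b_{2j}`
    (∀ i j : ℕ, (i = 0 ∧ j = 0) ∨ (1 ≤ i ∧ 1 ≤ j) →
      ⁅Tetrahedron.b F (2 * i), Tetrahedron.b F (2 * j)⁆ = 0) ∧
    (∀ i : ℕ, 1 ≤ i →
      ⁅Tetrahedron.b F (2 * i), Tetrahedron.b F 0⁆ = (4 : F) • Tetrahedron.a F (2 * i - 1)) ∧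
    -- the bracket of `a_{2i}` and `a_{2j+1}`
    (∀ j : ℕ,
      ⁅Tetrahedron.a F 0, Tetrahedron.a F (2 * j + 1)⁆ = Tetrahedron.a F (2 * j + 2)) ∧
    (∀ i j : ℕ, 1 ≤ i →
      ⁅Tetrahedron.a F (2 * i), Tetrahedron.a F (2 * j + 1)⁆ =
        Tetrahedron.a F (2 * i + 2 * j + 2) + (4 : F) • Tetrahedron.b F (2 * i + 2 * j)) ∧
    -- the bracket of `a_{2i+1}` and `b_{2j}`
    (∀ i : ℕ,
      ⁅Tetrahedron.a F (2 * i + 1), Tetrahedron.b F 0⁆ = Tetrahedron.b F (2 * i + 2)) ∧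
    (∀ i j : ℕ, 1 ≤ j →
      ⁅Tetrahedron.a F (2 * i + 1), Tetrahedron.b F (2 * j)⁆ =
        Tetrahedron.b F (2 * i + 2 * j + 2) + (4 : F) • Tetrahedron.a F (2 * i + 2 * j)) ∧
    -- the bracket of `a_{2i+1}` and `a_{2j+1}`
    (∀ i j : ℕ,
      ⁅Tetrahedron.a F (2 * i + 1), Tetrahedron.a F (2 * j + 1)⁆ = 0) := by
  have h := Tetrahedron.dolanGrady_ox F
  have ev : ∀ {i : ℕ}, 1 ≤ i → ∃ k, i = k + 1 := fun hi => ⟨_, (Nat.sub_add_cancel hi).symm⟩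
  refine ⟨⟨Module.Basis.mk (Tetrahedron.linearIndependent_onsagerFamily_ox F)
    (Tetrahedron.span_onsagerFamily_ox F), ?_, ?_, ?_⟩, ?_, ?_, ?_, ?_, ?_, ?_, ?_, ?_, ?_, ?_,
    ?_, ?_⟩
  · intro i; rw [Module.Basis.mk_apply]; rfl
  · intro i; rw [Module.Basis.mk_apply]; rfl
  · intro i; rw [Module.Basis.mk_apply]; rfl
  · rintro i j (⟨rfl, rfl⟩ | ⟨hi, hj⟩)
    · exact lie_self _
    · obtain ⟨i, rfl⟩ := ev hi
      obtain ⟨j, rfl⟩ := ev hj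
      exact h.even_lie_even i j
  · intro j hj
    obtain ⟨j, rfl⟩ := ev hj
    exact h.left_lie_even j
  · intro i
    rcases i with _ | i
    · exact (Tetrahedron.altBracket_one _ _).symm
    · exact h.swap_even_lie_left i
  · intro j _
    exact (Tetrahedron.altBracket_odd _ _ j).symm
  · intro i j hi hj
    obtain ⟨i, rfl⟩ := ev hi
    obtain ⟨j, rfl⟩ := ev hj
    -- Both indices being positive, the truncated subtraction of 3 is a genuine one.
    rw [show 2 * (i + 1) + 2 * (j + 1) + 1 = 2 * (i + j) + 5 by ring,
      show 2 * (i + 1) + 2 * (j + 1) - 3 = 2 * (i + j) + 1 by omega]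
    exact h.swap_even_lie_even i j
  · rintro i j (⟨rfl, rfl⟩ | ⟨hi, hj⟩)
    · exact lie_self _
    · obtain ⟨i, rfl⟩ := ev hi
      obtain ⟨j, rfl⟩ := ev hj
      exact h.symm.even_lie_even i j
  · intro i hi
    obtain ⟨i, rfl⟩ := ev hi
    change ⁅Tetrahedron.altBracket _ _ (2 * i + 2), Tetrahedron.ox03 F⁆ = (4 : F) •
      Tetrahedron.altBracket _ _ (2 * i + 1)
    rw [← lie_skew, h.symm.left_lie_even, h.altBracket_swap_odd, smul_neg, neg_neg]
  · intro j
    exact (Tetrahedron.altBracket_even _ _ j).symm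
  · intro i j hi
    obtain ⟨i, rfl⟩ := ev hi
    rw [show 2 * (i + 1) + 2 * j + 2 = 2 * (i + j) + 4 by ring,
      show 2 * (i + 1) + 2 * j = 2 * (i + j) + 2 by ring]
    exact h.even_lie_odd i j
  · intro i
    change ⁅Tetrahedron.altBracket _ _ (2 * i + 1), Tetrahedron.ox03 F⁆ =
      Tetrahedron.altBracket _ _ (2 * i + 2)
    rw [h.altBracket_swap_even, lie_skew]
  · intro i j hj
    obtain ⟨j, rfl⟩ := ev hj
    rw [show 2 * i + 2 * (j + 1) + 2 = 2 * (j + i) + 4 by ring,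
      show 2 * i + 2 * (j + 1) = 2 * (j + i) + 2 by ring]
    -- Swapping `u` and `v` exchanges the `a` and `b` families; the sign on odd brackets absorbs the
    -- reversed order of the bracket.
    refine Eq.trans ?_ (h.symm.even_lie_odd j i)
    rw [h.altBracket_swap_odd, lie_neg, lie_skew]
    rfl
  · exact h.odd_lie_odd
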